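/- Let $p$ be a prime. For integers $1\le a\le b$ and any field $F$ of characteristic $p$, let $J_k$ denote the unipotent $k\times k$ Jordan block over $F$ (entries $1$ on the diagonal and the superdiagonal, $0$ elsewhere). The Jordan canonical form of $J_a\otimes J_b$ is $\bigoplus_{i=1}^{a}J_{\lambda_i}$ for a unique sequence $\lambda_1\ge\cdots\ge\lambda_a>0$, which depends only on $(a,b,p)$, and $n\mapsto (a+1-n)+b-\lambda_n$ is a permutation $\pi(a,b,p)$ of $[a]=\{1,\dots,a\}$, the Norman permutation. For $1\le i\le j\le a$ let $\mathrm{Rev}(i,j)$ be the permutation of $[a]$ which sends $n$ to $i+j-n$ for $i\le n\le j$ and fixes all other points. For $k<a$, permutations of $[k]$ are regarded as permutations of $[a]$ fixing $k+1,\dots,a$. Permutations act on the right, so that $f\circ g$ is $f$ followed by $g$, and $f^g=g^{-1}\circ f\circ g$. Let $r,s_0,s_1,m$ be integers with $m\ge 0$, $1\le s_0<p$ and $1\le s_1<r<p^m$. Then the following hold, where the Norman permutations involved are well defined in the above sense. (a) If $s=s_0p^m+s_1$, then $\pi(r,s,p)=\pi(s_1,r,p)\circ\mathrm{Rev}(s_1+1,r)$.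 (b) If $s'=(s_0+1)p^m-s_1$, then $\pi(r,s',p)=\mathrm{Rev}(1,r-s_1)\circ\pi(s_1,r,p)^{\mathrm{Rev}(1,r)}$. -/

import Mathlib

/-!  Permutations of `[r] = {1, ..., r}` are represented by permutations of `ℕ` which fix every
`n ∉ {1, ..., r}`; so `S_m` is the subgroup of `S_n`, for `m < n`, which fixes
`m + 1, ..., n`. -/

namespace NormanPermutation

/-- The nilpotent Jordan block of degree `r`: entry `1` in the positions `(i, i+1)`, and `0`
elsewhere. -/
def nilBlock (F : Type*) [Field F] (r : ℕ) : Matrix (Fin r) (Fin r) F :=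
  Matrix.of fun i j => if (i : ℕ) + 1 = (j : ℕ) then 1 else 0

/-- The unipotent Jordan block `J_r = I_r + N_r`. -/
def jordanBlock (F : Type*) [Field F] (r : ℕ) : Matrix (Fin r) (Fin r) F :=
  1 + nilBlock F r

/-- Similarity of two square matrices, whose index types may differ: `B = P * A * P⁻¹`,
where `Q` is the inverse of `P`. -/
def AreSimilar {F : Type*} [Field F] {ι κ : Type*} [Fintype ι] [Fintype κ]
    [DecidableEq ι] [DecidableEq κ] (A : Matrix ι ι F) (B : Matrix κ κ F) : Prop :=
  ∃ (P : Matrix κ ι F) (Q : Matrix ι κ F), P * Q = 1 ∧ Q * P = 1 ∧ P * A * Q = B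

/-- `lam = (λ_1 ≥ ⋯ ≥ λ_r > 0)` is the partition for which the Jordan canonical form of
`J_r ⊗ J_s` over `F` is the block diagonal matrix `J_{λ_1} ⊕ ⋯ ⊕ J_{λ_r}`.
The part `λ_{i+1}` is `lam i`, for `i : Fin r`. -/
def IsJordanPartition (F : Type*) [Field F] (r s : ℕ) (lam : Fin r → ℕ) : Prop :=
  Antitone lam ∧ (∀ i, 0 < lam i) ∧
    AreSimilar (Matrix.kronecker (jordanBlock F r) (jordanBlock F s))
      (Matrix.blockDiagonal' fun i : Fin r => jordanBlock F (lam i))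

/-- `σ` is the permutation of `{1, ..., r}` which sends `n` to `(r + 1 - n) + s - λ_n`, where
`λ` is the Jordan partition of `J_r ⊗ J_s` over `F`. -/
def IsNormanPerm (F : Type*) [Field F] (r s : ℕ) (σ : Equiv.Perm ℕ) : Prop :=
  ∃ lam : Fin r → ℕ, IsJordanPartition F r s lam ∧
    (∀ i : Fin r, ((σ ((i : ℕ) + 1) : ℕ) : ℤ)
      = ((r : ℤ) + 1 - ((i : ℤ) + 1)) + (s : ℤ) - (lam i : ℤ)) ∧
    (∀ n : ℕ, n ∉ Finset.Icc 1 r → σ n = n)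

/-- The Norman permutation `π(r, s, p)`, formed over the prime field of characteristic `p`.
(That it exists, is unique, and is the same over each field of characteristic `p` has to be
proved where it is used.) -/
noncomputable def normanPerm (p : ℕ) [Fact p.Prime] (r s : ℕ) : Equiv.Perm ℕ :=
  Classical.epsilon fun σ => IsNormanPerm (ZMod p) r s σ

/-- The map which reverses the sequence `(i, i+1, ..., j)` and fixes all other numbers. -/
def revFun (i j n : ℕ) : ℕ := if i ≤ n ∧ n ≤ j then i + j - n else n

theorem revFun_involutive (i j : ℕ) : Function.Involutive (revFun i j) := by
  intro n
  unfold revFun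
  split_ifs <;> omega

/-- The reversal permutation `Rev(i, j)`. -/
def Rev (i j : ℕ) : Equiv.Perm ℕ := (revFun_involutive i j).toPerm

end NormanPermutation

/-! `J_a ⊗ J_b` is similar to `1 + (x + y)` acting on `F[x, y] / (x ^ a, y ^ b)`, so the parts of
the Jordan partition are the lengths of the Jordan chains of a graded operator. A form is stored as
a polynomial in `X` (put `y = 1`), and `x + y` becomes `1 + X`.

Let `a ≤ b`. Each degree `n < a` starts one chain, of length `λ_n = chainLength F a b n`. From
degree `b - 1` on, the kernel of `x + y` is at most one-dimensional in each degree, so the numbers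
`n + λ_n` are distinct (`add_chainLength_injOn`). They lie in `[b, a + b)`, so `dualDegree`, the
Norman permutation indexed from `0`, is a permutation. Hence the `λ_n` sum to `a * b`, and the
chains, being independent, form a basis.

For `r ≤ q = p ^ m`, `(x + y) ^ (N * q) ≡ y ^ (N * q)` modulo `x ^ r`. Replacing `y ^ t` by `y ^ (N
* q + t)` therefore lengthens the chains starting below degree `t` by `N * q`. For `y ^ (N * q -
t)`, if `(x + y) ^ l * f ≡ y ^ t * h` ends a chain for `y ^ t`, then `h` starts one of length at
most `N * q - l`. Such upper bounds have the right total, so `sum_chainLength` makes them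
equalities. The two formulas are the resulting chain lengths read as permutations. -/

namespace NormanPermutation

/-! ### Jordan chains of `x + y` on `F[x, y] / (x ^ a, y ^ b)`. -/

section ChainLength

open Polynomial

variable {F : Type*} [Field F]

/-- A polynomial `f` of degree at most `d` stands for the form `∑ i, f_i x ^ i y ^ (d - i)`;
this says that the form lies in the ideal `(x ^ a, y ^ b)`. -/
def VanishesInDegree (a b d : ℕ) (f : F[X]) : Prop :=
  ∀ i, i < a → d < b + i → f.coeff i = 0

variable (F) in
/-- There is a form of degree `n` which is not divisible by `x + y`, and which is annihilated by
`(x + y) ^ k` modulo `(x ^ a, y ^ b)`. -/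
def HasGenerator (a b n k : ℕ) : Prop :=
  ∃ f : F[X], f.natDegree ≤ n ∧ f.eval (-1) ≠ 0 ∧ VanishesInDegree a b (n + k) ((1 + X) ^ k * f)

variable (F) in
/-- The length of the Jordan chain of `x + y` on `F[x, y] / (x ^ a, y ^ b)` which starts in
degree `n`. -/
noncomputable def chainLength (a b n : ℕ) : ℕ := sInf {k | HasGenerator F a b n k}

theorem natDegree_one_add_X_pow_mul_le {n k : ℕ} {f : F[X]} (hf : f.natDegree ≤ n) :
    ((1 + X) ^ k * f).natDegree ≤ n + k := by
  have h1 : ((1 + X : F[X]) ^ k).natDegree ≤ k := by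
    have : (1 + X : F[X]).natDegree ≤ 1 := by
      refine (natDegree_add_le _ _).trans ?_
      simp
    calc _ ≤ k * (1 + X : F[X]).natDegree := natDegree_pow_le
      _ ≤ k * 1 := Nat.mul_le_mul_left _ this
      _ = k := mul_one k
  refine natDegree_mul_le.trans ?_
  omega

theorem X_pow_dvd_of_dvd_one_add_X_pow_mul {r k : ℕ} {f : F[X]} (h : X ^ r ∣ (1 + X) ^ k * f) :
    X ^ r ∣ f := by
  have hc : IsCoprime (X : F[X]) (1 + X) := ⟨-1, 1, by ring⟩
  exact hc.pow.dvd_of_dvd_mul_left h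

theorem eval_one_add_X_pow_mul {k : ℕ} (hk : k ≠ 0) (f : F[X]) :
    ((1 + X) ^ k * f).eval (-1) = 0 := by
  simp [hk]

theorem coeff_one_add_X_mul_succ (f : F[X]) (i : ℕ) :
    ((1 + X) * f).coeff (i + 1) = f.coeff (i + 1) + f.coeff i := by
  rw [add_mul, one_mul, coeff_add, coeff_X_mul]

theorem VanishesInDegree.one_add_X_mul {a b d : ℕ} {f : F[X]} (h : VanishesInDegree a b d f) :
    VanishesInDegree a b (d + 1) ((1 + X) * f) := by
  intro i hi hd
  cases i with
  | zero => simpa [add_mul] using h 0 hi (by omega)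
  | succ i =>
    rw [coeff_one_add_X_mul_succ, h (i + 1) hi (by omega), h i (by omega) (by omega), add_zero]

theorem hasGenerator_of_le_add {a b n k : ℕ} (h : a + b ≤ n + k + 1) : HasGenerator F a b n k := by
  refine ⟨1, by simp, by simp, fun i hi hd => ?_⟩
  omega

theorem HasGenerator.succ_degree {a b n k : ℕ} (h : HasGenerator F a b n k) :
    HasGenerator F a b (n + 1) k := by
  obtain ⟨f, hf, hf', hv⟩ := h
  refine ⟨X * f, ?_, by simpa using hf', fun i hi hd => ?_⟩
  · refine natDegree_mul_le.trans ?_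
    rw [natDegree_X]
    omega
  · rw [mul_left_comm]
    cases i with
    | zero => simp
    | succ i => rw [coeff_X_mul]; exact hv i (by omega) (by omega)

theorem HasGenerator.succ {a b n k : ℕ} (h : HasGenerator F a b n k) :
    HasGenerator F a b n (k + 1) := by
  obtain ⟨f, hf, hf', hv⟩ := h
  refine ⟨f, hf, hf', ?_⟩
  rw [pow_succ', mul_assoc]
  exact hv.one_add_X_mul

theorem HasGenerator.mono {a b n k l : ℕ} (h : HasGenerator F a b n k) (hkl : k ≤ l) :
    HasGenerator F a b n l := by
  induction l, hkl using Nat.le_induction with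
  | base => exact h
  | succ l _ ih => exact ih.succ

theorem hasGenerator_chainLength (a b n : ℕ) : HasGenerator F a b n (chainLength F a b n) :=
  Nat.sInf_mem (s := {k | HasGenerator F a b n k})
    ⟨a + b, hasGenerator_of_le_add (by omega)⟩

theorem chainLength_le {a b n k : ℕ} (h : HasGenerator F a b n k) : chainLength F a b n ≤ k :=
  Nat.sInf_le h

theorem hasGenerator_iff {a b n k : ℕ} : HasGenerator F a b n k ↔ chainLength F a b n ≤ k :=
  ⟨chainLength_le, (hasGenerator_chainLength a b n).mono⟩

theorem not_hasGenerator_zero {a b n : ℕ} (ha : n < a) (hb : n < b) :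
    ¬ HasGenerator F a b n 0 := by
  rintro ⟨f, hf, hf', hv⟩
  refine hf' ?_
  have : f = 0 := by
    ext i
    rcases lt_or_ge i a with hi | hi
    · simpa using hv i hi (by omega)
    · exact coeff_eq_zero_of_natDegree_lt (by omega)
  simp [this]

theorem chainLength_pos {a b n : ℕ} (ha : n < a) (hb : n < b) : 0 < chainLength F a b n := by
  by_contra h
  exact not_hasGenerator_zero (F := F) ha hb (hasGenerator_iff.2 (by omega))

theorem chainLength_antitone (a b : ℕ) : Antitone (chainLength F a b) :=
  antitone_nat_of_succ_le fun n =>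
    chainLength_le (hasGenerator_chainLength a b n).succ_degree

theorem add_chainLength_lt {a b n : ℕ} (ha : n < a) (hb : 0 < b) :
    n + chainLength F a b n < a + b := by
  have := chainLength_le (F := F) (hasGenerator_of_le_add (a := a) (b := b) (n := n)
    (k := a + b - 1 - n) (by omega))
  omega

/-- In degrees below `b` the ideal is just `(x ^ a)`. Since `X` and `1 + X` are coprime, `X ^ a`
would divide `f` itself, which has degree less than `a`. -/
theorem le_add_chainLength {a b n : ℕ} (ha : n < a) : b ≤ n + chainLength F a b n := by
  by_contra! hlt
  obtain ⟨f, hf, hf', hv⟩ := hasGenerator_chainLength (F := F) a b n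
  refine hf' ?_
  have h1 : X ^ a ∣ f := X_pow_dvd_of_dvd_one_add_X_pow_mul (k := chainLength F a b n)
    (X_pow_dvd_iff.2 fun i hi => hv i hi (by omega))
  have : f = 0 := eq_zero_of_dvd_of_natDegree_lt h1 (by rw [natDegree_X_pow]; omega)
  simp [this]

/-- A form which `x + y` multiplies into `(x ^ a, y ^ b)` lies in `(x ^ a, y ^ b)` as soon as its
first coefficient outside `(y ^ b)` vanishes. -/
theorem VanishesInDegree.of_one_add_X_mul {a b d : ℕ} {f : F[X]} (hbd : b ≤ d + 1)
    (h : VanishesInDegree a b (d + 1) ((1 + X) * f)) (h0 : f.coeff (d + 1 - b) = 0) :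
    VanishesInDegree a b d f := by
  intro i hi hd
  obtain ⟨k, rfl⟩ : ∃ k, i = d + 1 - b + k := ⟨i - (d + 1 - b), by omega⟩
  clear hd
  induction k with
  | zero => exact h0
  | succ k ih =>
    have h2 := h (d + 1 - b + k + 1) (by omega) (by omega)
    rwa [coeff_one_add_X_mul_succ, ih (by omega), add_zero] at h2

/-- Otherwise the last nonzero members `u`, `w` of both chains lie in the same degree and are killed
by `x + y`. The kernel there is at most one-dimensional, so a combination vanishes and one chain
could be shortened. -/
theorem add_chainLength_injOn {a b n n' : ℕ} (hn' : n' < a) (hab : a ≤ b) (hlt : n < n') :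
    n + chainLength F a b n ≠ n' + chainLength F a b n' := by
  intro he
  obtain ⟨f, hf, hf', hv⟩ := hasGenerator_chainLength (F := F) a b n
  obtain ⟨g, hg, hg', hw⟩ := hasGenerator_chainLength (F := F) a b n'
  have hb := le_add_chainLength (F := F) (b := b) hn'
  obtain ⟨k, hk⟩ : ∃ k, chainLength F a b n = k + 1 :=
    Nat.exists_eq_succ_of_ne_zero (chainLength_pos (by omega) (by omega)).ne'
  obtain ⟨l, hl⟩ : ∃ l, chainLength F a b n' = l + 1 :=
    Nat.exists_eq_succ_of_ne_zero (chainLength_pos (by omega) (by omega)).ne'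
  rw [hk] at hv
  rw [hl] at hw
  set u := (1 + X) ^ k * f with hu
  set w := (1 + X) ^ l * g with hw'
  have hu1 : VanishesInDegree a b (n' + l + 1) ((1 + X) * u) := by
    rw [hu, ← mul_assoc, ← pow_succ']
    convert hv using 1
    omega
  have hw1 : VanishesInDegree a b (n' + l + 1) ((1 + X) * w) := by
    rw [hw', ← mul_assoc, ← pow_succ']
    exact hw
  set c := u.coeff (n' + l + 1 - b)
  set e := w.coeff (n' + l + 1 - b)
  by_cases hc : c = 0
  · have : HasGenerator F a b n k := by
      refine ⟨f, hf, hf', ?_⟩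
      have := hu1.of_one_add_X_mul (by omega) hc
      convert this using 1
      omega
    have := chainLength_le this
    omega
  · have : HasGenerator F a b n' l := by
      -- The coefficients `e`, `c` cancel the first coefficient of `e * u - c * w` outside `(y ^
      -- b)`. As `n < n'`, the first term vanishes at `-1`, leaving `-c * g(-1) ≠ 0`.
      refine ⟨C e * ((1 + X) ^ (n' - n) * f) - C c * g, ?_, ?_, ?_⟩
      · refine (natDegree_sub_le _ _).trans (max_le ?_ ?_)
        · refine (natDegree_C_mul_le _ _).trans ?_
          refine (natDegree_one_add_X_pow_mul_le hf).trans ?_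
          omega
        · exact (natDegree_C_mul_le _ _).trans hg
      · rw [eval_sub, eval_mul, eval_one_add_X_pow_mul (by omega)]
        simp [hc, hg']
      · have hz : (1 + X) ^ l * (C e * ((1 + X) ^ (n' - n) * f) - C c * g) =
            C e * u - C c * w := by
          have : k = l + (n' - n) := by omega
          rw [hu, hw', this, pow_add]
          ring
        rw [hz]
        refine VanishesInDegree.of_one_add_X_mul (by omega) ?_ ?_
        · intro i hi hd
          have : (1 + X) * (C e * u - C c * w) = C e * ((1 + X) * u) - C c * ((1 + X) * w) := by
            ring
          rw [this, coeff_sub, coeff_C_mul, coeff_C_mul, hu1 i hi hd, hw1 i hi hd]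
          simp
        · rw [coeff_sub, coeff_C_mul, coeff_C_mul]
          exact sub_eq_zero.2 (mul_comm e c)
    have := chainLength_le this
    omega

variable (F) in
/-- The permutation `n ↦ a + b - 1 - n - λ_n` of `{0, ..., a - 1}`, where `λ_n` is the chain
length. -/
noncomputable def dualDegree (a b n : ℕ) : ℕ := a + b - 1 - (n + chainLength F a b n)

theorem add_chainLength_add_dualDegree {a b n : ℕ} (ha : n < a) (hab : a ≤ b) :
    n + chainLength F a b n + dualDegree F a b n = a + b - 1 := by
  have := add_chainLength_lt (F := F) ha (b := b) (by omega)
  unfold dualDegree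
  omega

theorem dualDegree_lt {a b n : ℕ} (ha : n < a) (hab : a ≤ b) : dualDegree F a b n < a := by
  have := add_chainLength_add_dualDegree (F := F) ha hab
  have := le_add_chainLength (F := F) (b := b) ha
  omega

theorem dualDegree_injOn {a b : ℕ} (hab : a ≤ b) :
    Set.InjOn (dualDegree F a b) (Finset.range a : Set ℕ) := by
  intro n hn n' hn' h
  rw [Finset.coe_range, Set.mem_Iio] at hn hn'
  have h1 := add_chainLength_add_dualDegree (F := F) hn hab
  have h2 := add_chainLength_add_dualDegree (F := F) hn' hab
  rcases lt_trichotomy n n' with h3 | h3 | h3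
  · exact absurd (by omega) (add_chainLength_injOn (F := F) hn' hab h3)
  · exact h3
  · exact absurd (by omega) (add_chainLength_injOn (F := F) hn hab h3)

theorem image_dualDegree {a b : ℕ} (hab : a ≤ b) :
    (Finset.range a).image (dualDegree F a b) = Finset.range a := by
  refine Finset.eq_of_subset_of_card_le ?_ ?_
  · intro i hi
    obtain ⟨n, hn, rfl⟩ := Finset.mem_image.1 hi
    exact Finset.mem_range.2 (dualDegree_lt (Finset.mem_range.1 hn) hab)
  · rw [Finset.card_image_of_injOn (dualDegree_injOn hab)]

theorem sum_comp_dualDegree {a b : ℕ} (hab : a ≤ b) (g : ℕ → ℕ) :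
    ∑ n ∈ Finset.range a, g (dualDegree F a b n) = ∑ n ∈ Finset.range a, g n := by
  conv_rhs => rw [← image_dualDegree (F := F) hab]
  rw [Finset.sum_image (dualDegree_injOn hab)]

/-- Sum `n + λ_n + dualDegree n = a + b - 1` over `n < a`; the first and last terms have equal sums
because `dualDegree` is a permutation. -/
theorem sum_chainLength {a b : ℕ} (hab : a ≤ b) :
    ∑ n ∈ Finset.range a, chainLength F a b n = a * b := by
  have h1 : ∑ n ∈ Finset.range a, (n + chainLength F a b n + dualDegree F a b n) =
      ∑ n ∈ Finset.range a, (a + b - 1) :=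
    Finset.sum_congr rfl fun n hn => add_chainLength_add_dualDegree (Finset.mem_range.1 hn) hab
  rw [Finset.sum_add_distrib, Finset.sum_add_distrib, sum_comp_dualDegree hab (fun n => n),
    Finset.sum_const, Finset.card_range, smul_eq_mul] at h1
  have h2 := Finset.sum_range_id_mul_two a
  rcases Nat.eq_zero_or_pos a with rfl | ha
  · simp
  · obtain ⟨c, rfl⟩ : ∃ c, a = c + 1 := ⟨a - 1, by omega⟩
    have h3 : c + 1 + b - 1 = c + b := by omega
    rw [h3] at h1
    rw [Nat.add_sub_cancel] at h2
    nlinarith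

/-- The members of degree `d` of the Jordan chains are linearly independent modulo
`(x ^ a, y ^ b)`. -/
theorem chain_linearIndependent {a b d : ℕ} {f : ℕ → F[X]}
    (hdeg : ∀ n < a, (f n).natDegree ≤ n) (heval : ∀ n < a, (f n).eval (-1) ≠ 0)
    {c : ℕ → F} (hc : ∀ n, ¬ (n < a ∧ n ≤ d ∧ d < n + chainLength F a b n) → c n = 0)
    (hv : VanishesInDegree a b d
      (∑ n ∈ Finset.range a, C (c n) * ((1 + X) ^ (d - n) * f n))) :
    ∀ n, c n = 0 := by
  by_contra! hne
  have hfin : ∀ n, c n ≠ 0 → n < a := fun n hn => by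
    by_contra h
    exact hn (hc n fun h' => h h'.1)
  obtain ⟨N, hN, hmax⟩ : ∃ N, c N ≠ 0 ∧ ∀ n, N < n → c n = 0 := by
    classical
    obtain ⟨n₀, hn₀⟩ := hne
    have hs : ((Finset.range a).filter fun n => c n ≠ 0).Nonempty :=
      ⟨n₀, by simpa using ⟨hfin _ hn₀, hn₀⟩⟩
    refine ⟨_, (Finset.mem_filter.1 (Finset.max'_mem _ hs)).2, fun n hn => ?_⟩
    by_contra h
    have := Finset.le_max' ((Finset.range a).filter fun n => c n ≠ 0) n
      (by simpa using ⟨hfin _ h, h⟩)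
    omega
  obtain ⟨hNa, hNd, hNl⟩ : N < a ∧ N ≤ d ∧ d < N + chainLength F a b N := by
    by_contra h
    exact hN (hc N h)
  -- With `N` the largest index in use, `(1 + X) ^ (d - N)` factors out of the relation. At `-1`
  -- only the term `N` of the cofactor survives, so the cofactor is a generator whose chain is too
  -- short.
  have : HasGenerator F a b N (d - N) := by
    refine ⟨∑ n ∈ Finset.range (N + 1), C (c n) * ((1 + X) ^ (N - n) * f n), ?_, ?_, ?_⟩
    · refine natDegree_sum_le_of_forall_le _ _ fun n hn => ?_
      have hn := Finset.mem_range.1 hn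
      refine (natDegree_C_mul_le _ _).trans
        ((natDegree_one_add_X_pow_mul_le (hdeg n (by omega))).trans ?_)
      omega
    · rw [Finset.sum_range_succ, eval_add, eval_finsetSum, Finset.sum_eq_zero, zero_add]
      · simpa using ⟨hN, heval N hNa⟩
      · intro n hn
        have hn := Finset.mem_range.1 hn
        rw [eval_mul, eval_one_add_X_pow_mul (by omega), mul_zero]
    · convert hv using 1
      · omega
      · rw [Finset.mul_sum]
        have hsub : Finset.range (N + 1) ⊆ Finset.range a := by
          intro n hn
          have := Finset.mem_range.1 hn
          exact Finset.mem_range.2 (by omega)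
        rw [← Finset.sum_subset hsub]
        · refine Finset.sum_congr rfl fun n hn => ?_
          have hn := Finset.mem_range.1 hn
          have : d - n = (d - N) + (N - n) := by omega
          rw [this, pow_add]
          ring
        · intro n _ hn
          rw [hmax n (by simpa using hn)]
          simp
  have := chainLength_le this
  omega

theorem reflect_one_add_X_pow_mul {n k : ℕ} {f : F[X]} (hf : f.natDegree ≤ n) :
    reflect (n + k) ((1 + X) ^ k * f) = (1 + X) ^ k * reflect n f := by
  induction k with
  | zero => simp
  | succ k ih =>
    have h1 : (1 + X : F[X]).natDegree ≤ 1 := by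
      simpa using natDegree_one_add_X_pow_mul_le (n := 0) (k := 1) (f := (1 : F[X])) (by simp)
    have h2 : reflect 1 (1 + X : F[X]) = 1 + X := by
      have h3 := reflect_monomial (R := F) 1 0
      have h4 := reflect_monomial (R := F) 1 1
      rw [pow_zero, revAt_zero, pow_one] at h3
      rw [revAt_le le_rfl, pow_one, Nat.sub_self, pow_zero] at h4
      rw [reflect_add, h3, h4, add_comm]
    rw [pow_succ', mul_assoc, show n + (k + 1) = 1 + (n + k) by omega,
      reflect_mul _ _ h1 (natDegree_one_add_X_pow_mul_le hf), ih, h2, mul_assoc]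

/-- Exchanging `x` and `y` reverses the coefficients of a form. -/
theorem HasGenerator.swap {a b n k : ℕ} (h : HasGenerator F a b n k) :
    HasGenerator F b a n k := by
  obtain ⟨f, hf, hf', hv⟩ := h
  refine ⟨reflect n f, ?_, ?_, ?_⟩
  · rw [natDegree_le_iff_coeff_eq_zero]
    intro i hi
    rw [coeff_reflect, revAt_eq_self_of_lt hi]
    exact coeff_eq_zero_of_natDegree_lt (by omega)
  · let _ : Invertible (-1 : F) := ⟨-1, by simp, by simp⟩
    have h1 := eval₂_reflect_mul_pow (RingHom.id F) (-1) n f hf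
    change eval (-1) (reflect n f) * (-1) ^ n = eval (-1) f at h1
    intro h2
    rw [h2, zero_mul] at h1
    exact hf' h1.symm
  · intro i hi hd
    rw [← reflect_one_add_X_pow_mul hf, coeff_reflect]
    rcases le_or_gt i (n + k) with h1 | h1
    · rw [revAt_le h1]
      exact hv _ (by omega) (by omega)
    · rw [revAt_eq_self_of_lt h1]
      exact coeff_eq_zero_of_natDegree_lt ((natDegree_one_add_X_pow_mul_le hf).trans_lt h1)

theorem chainLength_comm (a b n : ℕ) : chainLength F a b n = chainLength F b a n :=
  le_antisymm (chainLength_le (hasGenerator_chainLength b a n).swap)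
    (chainLength_le (hasGenerator_chainLength a b n).swap)

/-! ### Reduction modulo `p ^ m` in characteristic `p`. -/

section Reduction

variable {p : ℕ} [Fact p.Prime] [CharP F p]

/-- By Frobenius `(1 + X) ^ (N * p ^ m) = (1 + X ^ p ^ m) ^ N`, which is `1` modulo `X ^ r`. -/
theorem coeff_one_add_X_pow_mul {m r N i : ℕ} (hr : r ≤ p ^ m) (hi : i < r) (f : F[X]) :
    ((1 + X) ^ (N * p ^ m) * f).coeff i = f.coeff i := by
  have h1 : (X : F[X]) ^ r ∣ (1 + X) ^ (N * p ^ m) * f - f := by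
    have h2 : ((1 : F[X]) + X) ^ (N * p ^ m) = (1 + X ^ p ^ m) ^ N := by
      rw [mul_comm, pow_mul, add_pow_char_pow, one_pow]
    have h3 := sub_dvd_pow_sub_pow (1 + X ^ p ^ m : F[X]) 1 N
    rw [add_sub_cancel_left, one_pow] at h3
    have h4 : (1 + X) ^ (N * p ^ m) * f - f = ((1 + X ^ p ^ m) ^ N - 1) * f := by
      rw [h2]
      ring
    rw [h4]
    exact ((pow_dvd_pow X hr).trans h3).mul_right f
  have h5 := X_pow_dvd_iff.1 h1 i hi
  rwa [coeff_sub, sub_eq_zero] at h5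

-- Modulo `x ^ r`, the factor `(x + y) ^ (N * p ^ m)` acts as `y ^ (N * p ^ m)`, which cancels
-- against the same factor of `y ^ (N * p ^ m + t)`.
variable (p) in
theorem hasGenerator_mul_pow_add_iff {m r N t n k : ℕ} (hr : r ≤ p ^ m) :
    HasGenerator F r (N * p ^ m + t) n (N * p ^ m + k) ↔ HasGenerator F r t n k := by
  refine exists_congr fun f => and_congr_right fun _ => and_congr_right fun _ =>
    forall_congr' fun i => forall_congr' fun hi => ?_
  rw [pow_add, mul_assoc, coeff_one_add_X_pow_mul hr hi]
  constructor
  · intro h h'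
    exact h (by omega)
  · intro h h'
    exact h (by omega)

variable (p) in
theorem chainLength_mul_pow_add {m r N t n : ℕ} (hr : r ≤ p ^ m) (htr : t ≤ r) (hn : n < t) :
    chainLength F r (N * p ^ m + t) n = N * p ^ m + chainLength F t r n := by
  rw [chainLength_comm t r]
  refine le_antisymm (chainLength_le ((hasGenerator_mul_pow_add_iff p hr).2
    (hasGenerator_chainLength r t n))) ?_
  have h0 : N * p ^ m < chainLength F r (N * p ^ m + t) n := by
    by_contra! h
    exact not_hasGenerator_zero (F := F) (hn.trans_le htr) hn
      ((hasGenerator_mul_pow_add_iff (N := N) p hr).1 (hasGenerator_iff.2 h))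
  obtain ⟨k, hk⟩ := Nat.exists_eq_add_of_le h0.le
  have := hasGenerator_chainLength (F := F) r (N * p ^ m + t) n
  rw [hk, hasGenerator_mul_pow_add_iff p hr] at this
  rw [hk]
  have := chainLength_le this
  omega

-- In degree `t + i` the form `x ^ i * y ^ t` already lies in `(y ^ t)`, which bounds the length
-- above; comparing totals gives equality.
variable (p) in
theorem chainLength_mul_pow_add_of_le {m r N t n : ℕ} (hr : r ≤ p ^ m) (htr : t ≤ r)
    (hN : N ≠ 0) (htn : t ≤ n) (hn : n < r) :
    chainLength F r (N * p ^ m + t) n = N * p ^ m := by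
  have hle : ∀ i, chainLength F r (N * p ^ m + t) (t + i) ≤ N * p ^ m := by
    intro i
    refine chainLength_le ((hasGenerator_mul_pow_add_iff (k := 0) p hr).2 ?_)
    refine ⟨X ^ i, by simp, by simp, fun l _ hl => ?_⟩
    rw [pow_zero, one_mul, coeff_X_pow, if_neg (by omega)]
  have hq : p ^ m ≤ N * p ^ m := Nat.le_mul_of_pos_left _ (by omega)
  have h1 := sum_chainLength (F := F) (a := r) (b := N * p ^ m + t) (by omega)
  obtain ⟨c, rfl⟩ := Nat.exists_eq_add_of_le htr
  rw [Finset.sum_range_add, Finset.sum_congr rfl fun n hn =>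
    chainLength_mul_pow_add (F := F) p hr htr (Finset.mem_range.1 hn), Finset.sum_add_distrib,
    sum_chainLength htr, Finset.sum_const, Finset.card_range, smul_eq_mul] at h1
  have h2 : ∑ i ∈ Finset.range c, chainLength F (t + c) (N * p ^ m + t) (t + i) =
      ∑ i ∈ Finset.range c, N * p ^ m := by
    rw [Finset.sum_const, Finset.card_range, smul_eq_mul]
    nlinarith
  have h3 := (Finset.sum_eq_sum_iff_of_le fun i _ => hle i).1 h2 (n - t)
    (Finset.mem_range.2 (by omega))
  rwa [Nat.add_sub_cancel' htn] at h3

variable (p) in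
theorem chainLength_mul_pow_sub_le {m r N t : ℕ} (hr : r ≤ p ^ m) (n : ℕ) :
    chainLength F r (N * p ^ m - t) n ≤ N * p ^ m := by
  refine chainLength_le ⟨1, by simp, by simp, fun i hi hd => ?_⟩
  rw [coeff_one_add_X_pow_mul hr hi, coeff_one, if_neg (by omega)]

theorem exists_natDegree_le_coeff_eq (f : F[X]) (d : ℕ) :
    ∃ g : F[X], g.natDegree ≤ d ∧ ∀ i ≤ d, g.coeff i = f.coeff i := by
  refine ⟨f %ₘ X ^ (d + 1), ?_, fun i hi => ?_⟩
  · have := natDegree_modByMonic_lt f (monic_X_pow (d + 1)) (fun h => by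
      simpa using congrArg natDegree h)
    rw [natDegree_X_pow] at this
    omega
  · have h1 : X ^ (d + 1) ∣ f %ₘ X ^ (d + 1) - f :=
      ⟨-(f /ₘ X ^ (d + 1)), by
        linear_combination modByMonic_add_div f (X ^ (d + 1))⟩
    have := X_pow_dvd_iff.1 h1 i (by omega)
    rwa [coeff_sub, sub_eq_zero] at this

-- Linkage: modulo `x ^ r` write the end of a chain for `y ^ t` as `(x + y) ^ l * f ≡ y ^ t * h`,
-- with `h` of degree `j + l - t = r - 1 - dualDegree F t r j`. Multiplying by `(x + y) ^ (N * p ^ m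
-- - l)` and cancelling `y ^ t` gives `(x + y) ^ (N * p ^ m - l) * h ≡ y ^ (N * p ^ m - t) * f`.
variable (p) in
theorem chainLength_mul_pow_sub_dualDegree_le {m r N t j : ℕ} (hr : r ≤ p ^ m) (htr : t ≤ r)
    (hN : 2 ≤ N) (hj : j < t) :
    chainLength F r (N * p ^ m - t) (r - 1 - dualDegree F t r j) ≤
      N * p ^ m - chainLength F t r j := by
  have hd := add_chainLength_add_dualDegree (F := F) hj htr
  have hd' := dualDegree_lt (F := F) hj htr
  have hpos := chainLength_pos (F := F) hj (hj.trans_le htr)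
  have hq : 2 * p ^ m ≤ N * p ^ m := Nat.mul_le_mul_right _ hN
  obtain ⟨f, hf, hf', hv⟩ := hasGenerator_chainLength (F := F) r t j
  have hmin : ∀ k, HasGenerator F r t j k → chainLength F t r j ≤ k := by
    intro k hk
    rw [chainLength_comm t r]
    exact chainLength_le hk
  rw [chainLength_comm r t] at hv
  set l := chainLength F t r j
  set d := r - 1 - dualDegree F t r j with hd_def
  obtain ⟨h, hh, hcoeff⟩ := exists_natDegree_le_coeff_eq ((1 + X) ^ l * f) d
  have hdvd : X ^ r ∣ (1 + X) ^ l * f - h := by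
    refine X_pow_dvd_iff.2 fun i hi => ?_
    rw [coeff_sub, sub_eq_zero]
    rcases le_or_gt i d with h1 | h1
    · exact (hcoeff i h1).symm
    · rw [hv i hi (by omega)]
      exact (coeff_eq_zero_of_natDegree_lt (by omega)).symm
  refine chainLength_le ⟨h, hh, fun h0 => ?_, fun i hi hd => ?_⟩
  -- If `h = (1 + X) * g`, cancelling `1 + X` modulo `X ^ r` shows that `f` is annihilated already
  -- by the power `l - 1`, against the minimality of `l`.
  · obtain ⟨g, hg⟩ := dvd_iff_isRoot.2 h0
    have hg' : h = (1 + X) * g := by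
      rw [hg, C_neg, C_1]
      ring
    have hgdeg : ∀ i, d ≤ i → g.coeff i = 0 := by
      intro i hi
      rcases eq_or_ne g 0 with rfl | hg0
      · simp
      · refine coeff_eq_zero_of_natDegree_lt ?_
        have h1 : h.natDegree = 1 + g.natDegree := by
          rw [hg, natDegree_mul (X_sub_C_ne_zero _) hg0, natDegree_X_sub_C]
        omega
    obtain ⟨k, hk⟩ : ∃ k, l = k + 1 := ⟨l - 1, by omega⟩
    have h2 : X ^ r ∣ (1 + X) ^ k * f - g := by
      refine X_pow_dvd_of_dvd_one_add_X_pow_mul (k := 1) ?_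
      convert hdvd using 1
      rw [hg', hk]
      ring
    have h3 := hmin k ⟨f, hf, hf', fun i hi hd => by
      have h4 := X_pow_dvd_iff.1 h2 i hi
      rw [coeff_sub, hgdeg i (by omega), sub_zero] at h4
      exact h4⟩
    omega
  · have h1 : X ^ r ∣ (1 + X) ^ (N * p ^ m) * f - (1 + X) ^ (N * p ^ m - l) * h := by
      have h2 : N * p ^ m = (N * p ^ m - l) + l := by omega
      have h3 : (1 + X) ^ (N * p ^ m) * f - (1 + X) ^ (N * p ^ m - l) * h =
          (1 + X) ^ (N * p ^ m - l) * ((1 + X) ^ l * f - h) := by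
        conv_lhs => rw [h2, pow_add, Nat.add_sub_cancel]
        ring
      rw [h3]
      exact hdvd.mul_left _
    have h2 := X_pow_dvd_iff.1 h1 i hi
    rw [coeff_sub, sub_eq_zero, coeff_one_add_X_pow_mul hr hi] at h2
    rw [← h2]
    exact coeff_eq_zero_of_natDegree_lt (by omega)

-- All the upper bounds together add up to `r * (N * p ^ m - t)`, the exact total of the lengths, so
-- none is strict.
variable (p) in
theorem chainLength_mul_pow_sub_dualDegree {m r N t : ℕ} (hr : r ≤ p ^ m) (htr : t ≤ r)
    (hN : 2 ≤ N) :
    (∀ n < r - t, chainLength F r (N * p ^ m - t) n = N * p ^ m) ∧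
    ∀ j < t, chainLength F r (N * p ^ m - t) (r - 1 - dualDegree F t r j) =
      N * p ^ m - chainLength F t r j := by
  have hq : 2 * p ^ m ≤ N * p ^ m := Nat.mul_le_mul_right _ hN
  have h1 := sum_chainLength (F := F) (a := r) (b := N * p ^ m - t) (by omega)
  obtain ⟨c, rfl⟩ := Nat.exists_eq_add_of_le' htr
  have hle1 : ∀ n ∈ Finset.range c,
      chainLength F (c + t) (N * p ^ m - t) n ≤ N * p ^ m :=
    fun n _ => chainLength_mul_pow_sub_le p hr n
  have hle2 : ∀ j ∈ Finset.range t,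
      chainLength F (c + t) (N * p ^ m - t) (c + t - 1 - dualDegree F t (c + t) j) ≤
        N * p ^ m - chainLength F t (c + t) j :=
    fun j hj => chainLength_mul_pow_sub_dualDegree_le p hr htr hN (Finset.mem_range.1 hj)
  rw [Finset.sum_range_add, ← Finset.sum_range_reflect
    (fun i => chainLength F (c + t) (N * p ^ m - t) (c + i)) t] at h1
  have h2 : ∑ j ∈ Finset.range t,
      chainLength F (c + t) (N * p ^ m - t) (c + (t - 1 - j)) =
      ∑ j ∈ Finset.range t, chainLength F (c + t) (N * p ^ m - t)
        (c + t - 1 - dualDegree F t (c + t) j) := by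
    rw [sum_comp_dualDegree htr
      (fun j => chainLength F (c + t) (N * p ^ m - t) (c + t - 1 - j))]
    refine Finset.sum_congr rfl fun j hj => ?_
    have := Finset.mem_range.1 hj
    congr 1
    omega
  have h3 : ∑ j ∈ Finset.range t, (N * p ^ m - chainLength F t (c + t) j) + t * (c + t) =
      t * (N * p ^ m) := by
    rw [← sum_chainLength (F := F) htr, ← Finset.sum_add_distrib,
      Finset.sum_congr rfl (g := fun _ => N * p ^ m), Finset.sum_const, Finset.card_range,
      smul_eq_mul]
    intro j hj
    have hj := Finset.mem_range.1 hj
    have := add_chainLength_lt (F := F) (b := c + t) hj (by omega)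
    omega
  have h4 : ∑ n ∈ Finset.range c, N * p ^ m = c * (N * p ^ m) := by simp
  have h5 := Finset.sum_le_sum hle1
  have h6 := Finset.sum_le_sum hle2
  have h7 : (c + t) * (N * p ^ m - t) + (c + t) * t = (c + t) * (N * p ^ m) := by
    have : N * p ^ m - t + t = N * p ^ m := by omega
    rw [← mul_add, this]
  have e1 := (Finset.sum_eq_sum_iff_of_le hle1).1 (by nlinarith)
  have e2 := (Finset.sum_eq_sum_iff_of_le hle2).1 (by nlinarith)
  exact ⟨fun n hn => e1 n (Finset.mem_range.2 (by omega)),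
    fun j hj => e2 j (Finset.mem_range.2 hj)⟩

variable (p) in
theorem chainLength_mul_pow_sub_of_lt {m r N t n : ℕ} (hr : r ≤ p ^ m) (htr : t ≤ r)
    (hN : 2 ≤ N) (hn : n < r - t) : chainLength F r (N * p ^ m - t) n = N * p ^ m :=
  (chainLength_mul_pow_sub_dualDegree p hr htr hN).1 n hn

-- The permutation `dualDegree` drops out by sorting: the lengths at `r - 1 - j` and the numbers `N
-- * p ^ m - λ_j` are monotone in `j` and rearrange each other, hence agree.
variable (p) in
theorem chainLength_mul_pow_sub {m r N t j : ℕ} (hr : r ≤ p ^ m) (htr : t ≤ r)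
    (hN : 2 ≤ N) (hj : j < t) :
    chainLength F r (N * p ^ m - t) (r - 1 - j) = N * p ^ m - chainLength F t r j := by
  have hinj : Function.Injective
      (fun i : Fin t => (⟨dualDegree F t r i, dualDegree_lt i.2 htr⟩ : Fin t)) := by
    intro i i' h
    exact Fin.ext (dualDegree_injOn htr (by simp) (by simp) (Fin.mk.inj h))
  let σ : Equiv.Perm (Fin t) := Equiv.ofBijective _ (Finite.injective_iff_bijective.1 hinj)
  let u : Fin t → ℕ := fun i => chainLength F r (N * p ^ m - t) (r - 1 - i)
  have huσ : ∀ i, (u ∘ σ) i = N * p ^ m - chainLength F t r i := fun i =>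
    (chainLength_mul_pow_sub_dualDegree p hr htr hN).2 i i.2
  have hu : Monotone (u ∘ (1 : Equiv.Perm (Fin t))) := fun i i' h =>
    chainLength_antitone _ _ (Nat.sub_le_sub_left h _)
  have huσ' : Monotone (u ∘ σ) := fun i i' h => by
    rw [huσ, huσ]
    exact Nat.sub_le_sub_left (chainLength_antitone _ _ h) _
  have := congrFun (Tuple.unique_monotone hu huσ') ⟨j, hj⟩
  rw [huσ] at this
  exact this

end Reduction

end ChainLength

end NormanPermutation

namespace NormanPermutation

/-! ### Similarity of matrices. -/

section Similarity

open Matrix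

variable {F : Type*} [Field F] {ι κ ν : Type*} [Fintype ι] [Fintype κ] [Fintype ν]
  [DecidableEq ι] [DecidableEq κ] [DecidableEq ν]

theorem AreSimilar.symm {A : Matrix ι ι F} {B : Matrix κ κ F} (h : AreSimilar A B) :
    AreSimilar B A := by
  obtain ⟨P, Q, h1, h2, rfl⟩ := h
  refine ⟨Q, P, h2, h1, ?_⟩
  calc Q * (P * A * Q) * P = (Q * P) * A * (Q * P) := by simp only [Matrix.mul_assoc]
    _ = A := by simp [h2]

theorem AreSimilar.trans {A : Matrix ι ι F} {B : Matrix κ κ F} {C : Matrix ν ν F}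
    (h : AreSimilar A B) (h' : AreSimilar B C) : AreSimilar A C := by
  obtain ⟨P, Q, h1, h2, rfl⟩ := h
  obtain ⟨P', Q', h1', h2', rfl⟩ := h'
  refine ⟨P' * P, Q * Q', ?_, ?_, ?_⟩
  · calc P' * P * (Q * Q') = P' * (P * Q) * Q' := by simp only [Matrix.mul_assoc]
      _ = 1 := by simp [h1, h1']
  · calc Q * Q' * (P' * P) = Q * (Q' * P') * P := by simp only [Matrix.mul_assoc]
      _ = 1 := by simp [h2, h2']
  · simp only [Matrix.mul_assoc]

theorem AreSimilar.one_add {A : Matrix ι ι F} {B : Matrix κ κ F} (h : AreSimilar A B) :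
    AreSimilar (1 + A) (1 + B) := by
  obtain ⟨P, Q, h1, h2, rfl⟩ := h
  exact ⟨P, Q, h1, h2, by rw [Matrix.mul_add, Matrix.add_mul, Matrix.mul_one, h1]⟩

theorem AreSimilar.of_one_add {A : Matrix ι ι F} {B : Matrix κ κ F}
    (h : AreSimilar (1 + A) (1 + B)) : AreSimilar A B := by
  obtain ⟨P, Q, h1, h2, h3⟩ := h
  rw [Matrix.mul_add, Matrix.add_mul, Matrix.mul_one, h1] at h3
  exact ⟨P, Q, h1, h2, add_left_cancel h3⟩

theorem AreSimilar.pow {A : Matrix ι ι F} {B : Matrix κ κ F} (h : AreSimilar A B) (k : ℕ) :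
    AreSimilar (A ^ k) (B ^ k) := by
  obtain ⟨P, Q, h1, h2, rfl⟩ := h
  refine ⟨P, Q, h1, h2, ?_⟩
  induction k with
  | zero => simp [h1]
  | succ k ih =>
    rw [pow_succ (P * A * Q), ← ih]
    calc P * A ^ (k + 1) * Q = P * A ^ k * (Q * P) * (A * Q) := by
          rw [h2]
          simp only [Matrix.mul_assoc, pow_succ, Matrix.mul_one]
      _ = P * A ^ k * Q * (P * A * Q) := by
          simp only [Matrix.mul_assoc]

theorem AreSimilar.rank_le {A : Matrix ι ι F} {B : Matrix κ κ F} (h : AreSimilar A B) :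
    B.rank ≤ A.rank := by
  obtain ⟨P, Q, -, -, rfl⟩ := h
  exact (rank_mul_le_left _ _).trans (rank_mul_le_right _ _)

theorem AreSimilar.rank_eq {A : Matrix ι ι F} {B : Matrix κ κ F} (h : AreSimilar A B) :
    A.rank = B.rank :=
  le_antisymm h.symm.rank_le h.rank_le

theorem AreSimilar.map {K : Type*} [Field K] {A : Matrix ι ι F} {B : Matrix κ κ F}
    (h : AreSimilar A B) (f : F →+* K) : AreSimilar (A.map f) (B.map f) := by
  obtain ⟨P, Q, h1, h2, rfl⟩ := h
  refine ⟨P.map f, Q.map f, ?_, ?_, ?_⟩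
  · rw [← Matrix.map_mul, h1, Matrix.map_one f (map_zero f) (map_one f)]
  · rw [← Matrix.map_mul, h2, Matrix.map_one f (map_zero f) (map_one f)]
  · rw [← Matrix.map_mul, ← Matrix.map_mul]

theorem exists_inverse_of_vecMul_eq_zero {P : Matrix κ ι F}
    (hcard : Fintype.card κ = Fintype.card ι) (hP : ∀ c, c ᵥ* P = 0 → c = 0) :
    ∃ Q : Matrix ι κ F, P * Q = 1 ∧ Q * P = 1 := by
  have hinj : Function.Injective P.vecMulLinear :=
    (injective_iff_map_eq_zero P.vecMulLinear).2 fun c hc => hP c hc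
  have hsurj : Function.Surjective P.vecMulLinear :=
    (LinearMap.injective_iff_surjective_of_finrank_eq_finrank (by simpa using hcard)).1 hinj
  obtain ⟨Q, hQ⟩ := vecMul_surjective_iff_exists_left_inverse.1 hsurj
  exact ⟨Q, (mul_eq_one_comm_of_equiv (Fintype.equivOfCardEq hcard)).2 hQ, hQ⟩

end Similarity

/-! ### Jordan blocks: the nilpotent part of the tensor product, and uniqueness of the partition. -/

section JordanBlock

open Matrix

variable (F : Type*) [Field F]

theorem nilBlock_apply (r : ℕ) (i j : Fin r) :
    nilBlock F r i j = if (i : ℕ) + 1 = j then 1 else 0 := rfl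

theorem nilBlock_pow_apply (r k : ℕ) (i j : Fin r) :
    (nilBlock F r ^ k) i j = if (i : ℕ) + k = j then 1 else 0 := by
  induction k generalizing j with
  | zero => simp [Matrix.one_apply, Fin.ext_iff]
  | succ k ih =>
    rw [pow_succ, Matrix.mul_apply]
    simp only [ih, nilBlock_apply, ite_mul, one_mul, zero_mul]
    by_cases h : (i : ℕ) + (k + 1) = j
    · rw [if_pos h, Finset.sum_eq_single ⟨i + k, by omega⟩]
      · simp [← h, add_assoc]
      · intro l _ hl
        rw [if_neg]
        intro h'
        exact hl (Fin.ext h'.symm)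
      · simp
    · rw [if_neg h, Finset.sum_eq_zero]
      intro l _
      split_ifs <;> first | rfl | omega

theorem isUnit_jordanBlock (r : ℕ) : IsUnit (jordanBlock F r) := by
  refine IsNilpotent.isUnit_one_add ⟨r, ?_⟩
  ext i j
  rw [nilBlock_pow_apply, if_neg (by omega)]
  rfl

theorem sum_mul_nilBlock {r : ℕ} (v : ℕ → F) (j : Fin r) :
    ∑ i : Fin r, v i * nilBlock F r i j = if (j : ℕ) = 0 then 0 else v (j - 1) := by
  simp only [nilBlock_apply, mul_ite, mul_one, mul_zero]
  split_ifs with h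
  · exact Finset.sum_eq_zero fun i _ => if_neg (by omega)
  · rw [Finset.sum_eq_single ⟨j - 1, by omega⟩]
    · exact if_pos (Nat.succ_pred_eq_of_ne_zero h)
    · intro i _ hi
      refine if_neg fun h' => hi (Fin.ext ?_)
      change (i : ℕ) = j - 1
      omega
    · simp

theorem sum_nilBlock_mul {r : ℕ} (v : ℕ → F) (i : Fin r) :
    ∑ j : Fin r, nilBlock F r i j * v j = if (i : ℕ) + 1 < r then v (i + 1) else 0 := by
  simp only [nilBlock_apply, ite_mul, one_mul, zero_mul]
  split_ifs with h
  · rw [Finset.sum_eq_single ⟨i + 1, h⟩]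
    · exact if_pos rfl
    · exact fun j _ hj => if_neg fun h' => hj (Fin.ext h'.symm)
    · simp
  · exact Finset.sum_eq_zero fun j _ => if_neg (by omega)

/-- The change of variables `y ↦ y (1 + x)`. -/
theorem areSimilar_kronecker_jordanBlock (a b : ℕ) :
    AreSimilar (kronecker (jordanBlock F a) (jordanBlock F b))
      (1 + (kronecker (nilBlock F a) (1 : Matrix (Fin b) (Fin b) F) +
        kronecker (1 : Matrix (Fin a) (Fin a) F) (nilBlock F b))) := by
  set J := jordanBlock F a with hJ
  have hdet : IsUnit J.det := (isUnit_iff_isUnit_det _).1 (isUnit_jordanBlock F a)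
  have h1 : blockDiagonal (fun j : Fin b => J ^ (j : ℕ)) *
      blockDiagonal (fun j : Fin b => J⁻¹ ^ (j : ℕ)) = 1 := by
    rw [← blockDiagonal_mul, ← blockDiagonal_one]
    congr 1
    funext j
    rw [← (Commute.mul_pow ?_), mul_nonsing_inv _ hdet, one_pow, Pi.one_apply]
    rw [Commute, SemiconjBy, mul_nonsing_inv _ hdet, nonsing_inv_mul _ hdet]
  refine ⟨_, _, h1, mul_eq_one_comm.1 h1, ?_⟩
  have h2 : kronecker J (jordanBlock F b) = kronecker J 1 + kronecker J (nilBlock F b) :=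
    kronecker_add J 1 (nilBlock F b)
  have h3 : 1 + (kronecker (nilBlock F a) (1 : Matrix (Fin b) (Fin b) F) +
      kronecker (1 : Matrix (Fin a) (Fin a) F) (nilBlock F b)) =
      kronecker J 1 + kronecker 1 (nilBlock F b) := by
    have h : kronecker J (1 : Matrix (Fin b) (Fin b) F) =
        kronecker 1 1 + kronecker (nilBlock F a) 1 := add_kronecker 1 (nilBlock F a) 1
    have h' : kronecker (1 : Matrix (Fin a) (Fin a) F) (1 : Matrix (Fin b) (Fin b) F) = 1 :=
      one_kronecker_one
    rw [← add_assoc, h, h']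
  have h4 : blockDiagonal (fun j : Fin b => J ^ (j : ℕ)) * kronecker J 1 =
      kronecker J 1 * blockDiagonal (fun j : Fin b => J ^ (j : ℕ)) := by
    have h : kronecker J (1 : Matrix (Fin b) (Fin b) F) = blockDiagonal fun _ => J :=
      kronecker_one J
    rw [h, ← blockDiagonal_mul, ← blockDiagonal_mul]
    simp only [← pow_succ, ← pow_succ']
  have h5 : blockDiagonal (fun j : Fin b => J ^ (j : ℕ)) * kronecker J (nilBlock F b) =
      kronecker 1 (nilBlock F b) * blockDiagonal (fun j : Fin b => J ^ (j : ℕ)) := by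
    ext ⟨i, j⟩ ⟨i', j'⟩
    rw [Matrix.mul_apply, Matrix.mul_apply, Fintype.sum_prod_type, Fintype.sum_prod_type]
    simp only [kronecker, kroneckerMap_apply, blockDiagonal_apply, Matrix.one_apply, ite_mul,
      zero_mul, mul_ite, mul_zero, one_mul, Finset.sum_ite_eq, Finset.mem_univ, if_true,
      Finset.sum_ite_eq']
    simp only [← mul_assoc]
    -- Only `j' = j + 1` contributes, and there both sides are entries of `J ^ (j + 1)`.
    rw [← Finset.sum_mul, ← Matrix.mul_apply, ← pow_succ, nilBlock_apply]
    split_ifs with h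
    · rw [← h, mul_one, one_mul]
    · simp
  rw [h2, h3, Matrix.mul_add, h4, h5, ← Matrix.add_mul, Matrix.mul_assoc, h1, Matrix.mul_one]

theorem blockDiagonal'_jordanBlock {r : ℕ} (lam : Fin r → ℕ) :
    blockDiagonal' (fun i => jordanBlock F (lam i)) =
      1 + blockDiagonal' (fun i => nilBlock F (lam i)) := by
  rw [← blockDiagonal'_one, ← blockDiagonal'_add]
  rfl

/-- For `M` the power in question, `M * Mᵀ = D` is a diagonal projection with `D * M = M`, so `M`
and `D` have the same rank. -/
theorem rank_blockDiagonal'_nilBlock_pow {r : ℕ} (lam : Fin r → ℕ) (k : ℕ) :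
    (blockDiagonal' (fun i => nilBlock F (lam i)) ^ k).rank = ∑ i, (lam i - k) := by
  classical
  set w : (i : Fin r) → Fin (lam i) → F := fun i j => if (j : ℕ) + k < lam i then 1 else 0
    with hw
  set D : Matrix (Σ i, Fin (lam i)) (Σ i, Fin (lam i)) F :=
    diagonal fun x => w x.1 x.2 with hD
  have hD' : D = blockDiagonal' fun i => diagonal (w i) := (blockDiagonal'_diagonal w).symm
  have h0 : blockDiagonal' (fun i => nilBlock F (lam i)) ^ k =
      blockDiagonal' (fun i => nilBlock F (lam i) ^ k) :=
    (blockDiagonal'_pow _ _).symm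
  have h1 : D * blockDiagonal' (fun i => nilBlock F (lam i) ^ k) =
      blockDiagonal' (fun i => nilBlock F (lam i) ^ k) := by
    rw [hD', ← blockDiagonal'_mul]
    congr 1
    funext i
    ext j l
    rw [diagonal_mul, nilBlock_pow_apply, hw]
    split_ifs with h
    · rw [mul_one]
      exact if_pos (by omega)
    · rw [mul_zero]
  have h2 : blockDiagonal' (fun i => nilBlock F (lam i) ^ k) *
      (blockDiagonal' (fun i => nilBlock F (lam i) ^ k))ᵀ = D := by
    rw [hD', blockDiagonal'_transpose, ← blockDiagonal'_mul]
    congr 1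
    funext i
    ext j l
    rw [Matrix.mul_apply]
    simp only [transpose_apply, nilBlock_pow_apply, diagonal_apply, hw, mul_ite, mul_one, mul_zero,
      Fin.ext_iff]
    by_cases hj : (j : ℕ) + k < lam i
    · rw [Finset.sum_eq_single ⟨j + k, hj⟩]
      · simp [hj, eq_comm]
      · intro x _ hx
        have : ¬ (j : ℕ) + k = x := fun h => hx (Fin.ext h.symm)
        simp [this]
      · simp
    · rw [Finset.sum_eq_zero]
      · simp [hj]
      · intro x _
        have : ¬ (j : ℕ) + k = x := by omega
        simp [this]
  have h3 : (blockDiagonal' (fun i => nilBlock F (lam i)) ^ k).rank = D.rank := by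
    rw [h0]
    refine le_antisymm ?_ ?_
    · conv_lhs => rw [← h1]
      exact rank_mul_le_left _ _
    · rw [← h2]
      exact rank_mul_le_left _ _
  rw [h3, hD, rank_diagonal, Fintype.card_subtype, Finset.card_filter, Fintype.sum_sigma]
  refine Finset.sum_congr rfl fun i _ => ?_
  rw [Finset.sum_congr rfl (g := fun j : Fin (lam i) => if (j : ℕ) + k < lam i then 1 else 0),
    Fin.sum_univ_eq_sum_range (fun j => if j + k < lam i then 1 else 0), ← Finset.card_filter]
  · have : (Finset.range (lam i)).filter (fun j => j + k < lam i) = Finset.range (lam i - k) := by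
      ext j
      simp only [Finset.mem_filter, Finset.mem_range]
      omega
    rw [this, Finset.card_range]
  · intro j _
    simp [hw]

-- Consecutive differences of the sums count the parts larger than `k`, and these counts determine a
-- decreasing sequence.
variable {F} in
theorem eq_of_forall_sum_tsub_eq {r : ℕ} {lam mu : Fin r → ℕ} (hl : Antitone lam)
    (hm : Antitone mu) (h : ∀ k, ∑ i, (lam i - k) = ∑ i, (mu i - k)) : lam = mu := by
  have hcount : ∀ (nu : Fin r → ℕ) (k : ℕ), ∑ i, (nu i - k) =
      (Finset.univ.filter fun i => k < nu i).card + ∑ i, (nu i - (k + 1)) := by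
    intro nu k
    rw [Finset.card_filter, ← Finset.sum_add_distrib]
    refine Finset.sum_congr rfl fun i _ => ?_
    split_ifs <;> omega
  have hlt : ∀ (nu : Fin r → ℕ), Antitone nu → ∀ (k : ℕ) (i : Fin r),
      k < nu i ↔ (i : ℕ) < (Finset.univ.filter fun i => k < nu i).card := by
    intro nu hnu k i
    constructor
    · intro hk
      have : Finset.Iic i ⊆ Finset.univ.filter fun i => k < nu i := by
        intro j hj
        simpa using hk.trans_le (hnu (Finset.mem_Iic.1 hj))
      have := Finset.card_le_card this
      rw [Fin.card_Iic] at this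
      omega
    · intro hi
      by_contra hk
      have : (Finset.univ.filter fun i => k < nu i) ⊆ Finset.Iio i := by
        intro j hj
        rw [Finset.mem_Iio]
        by_contra! hij
        exact hk ((Finset.mem_filter.1 hj).2.trans_le (hnu hij))
      have := Finset.card_le_card this
      rw [Fin.card_Iio] at this
      omega
  have hiff : ∀ k i, k < lam i ↔ k < mu i := by
    intro k i
    have h1 := hcount lam k
    have h2 := hcount mu k
    have h3 := h k
    have h4 := h (k + 1)
    rw [hlt lam hl, hlt mu hm]
    omega
  funext i
  have h1 := hiff (lam i) i
  have h2 := hiff (mu i) i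
  omega

variable {F}

theorem IsJordanPartition.unique {a b : ℕ} {lam mu : Fin a → ℕ}
    (h : IsJordanPartition F a b lam) (h' : IsJordanPartition F a b mu) : lam = mu := by
  refine eq_of_forall_sum_tsub_eq h.1 h'.1 fun k => ?_
  have h1 := h.2.2.symm.trans h'.2.2
  rw [blockDiagonal'_jordanBlock, blockDiagonal'_jordanBlock] at h1
  have h2 := (h1.of_one_add.pow k).rank_eq
  rwa [rank_blockDiagonal'_nilBlock_pow, rank_blockDiagonal'_nilBlock_pow] at h2

theorem jordanBlock_map {K : Type*} [Field K] (f : F →+* K) (r : ℕ) :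
    (jordanBlock F r).map f = jordanBlock K r := by
  ext i j
  simp [jordanBlock, nilBlock, Matrix.one_apply, apply_ite f]

theorem IsJordanPartition.map {K : Type*} [Field K] (f : F →+* K) {a b : ℕ} {lam : Fin a → ℕ}
    (h : IsJordanPartition F a b lam) : IsJordanPartition K a b lam := by
  refine ⟨h.1, h.2.1, ?_⟩
  have h1 := h.2.2.map f
  rw [blockDiagonal'_map _ _ (map_zero f)] at h1
  simp only [jordanBlock_map] at h1
  convert h1 using 1
  ext ⟨i, j⟩ ⟨i', j'⟩
  simp [← jordanBlock_map f, kronecker]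

end JordanBlock

/-! ### The chains form a Jordan basis. -/

section JordanBasis

open Matrix Polynomial

variable {F : Type*} [Field F]

/-- The coefficient of `x ^ i y ^ j` in `(x + y) ^ k f`, for a form `f` of degree `n`. -/
noncomputable def chainCoeff (f : F[X]) (n k i j : ℕ) : F :=
  if i + j = n + k then ((1 + X) ^ k * f).coeff i else 0

theorem chainCoeff_succ {f : F[X]} {n : ℕ} (hf : f.natDegree ≤ n) (k i j : ℕ) :
    (if i = 0 then 0 else chainCoeff f n k (i - 1) j) +
      (if j = 0 then 0 else chainCoeff f n k i (j - 1)) = chainCoeff f n (k + 1) i j := by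
  have hdeg := natDegree_one_add_X_pow_mul_le (k := k) hf
  unfold chainCoeff
  rw [pow_succ', mul_assoc]
  cases i with
  | zero =>
    cases j with
    | zero => simp
    | succ j => simp [add_mul, ← add_assoc]
  | succ i =>
    rw [coeff_one_add_X_mul_succ]
    cases j with
    | zero =>
      by_cases h : i = n + k
      · subst h
        rw [coeff_eq_zero_of_natDegree_lt (n := n + k + 1) (by omega)]
        simp [← add_assoc]
      · simp [← add_assoc, h]
    | succ j =>
      have h1 : i + (j + 1) = n + k ↔ i + 1 + (j + 1) = n + (k + 1) := by omega
      have h2 : i + 1 + j = n + k ↔ i + 1 + (j + 1) = n + (k + 1) := by omega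
      simp only [Nat.add_sub_cancel, h1, h2]
      split_ifs <;> simp_all [add_comm]

variable (F) in
theorem areSimilar_blockDiagonal'_chainLength {a b : ℕ} (hab : a ≤ b) :
    AreSimilar (kronecker (nilBlock F a) (1 : Matrix (Fin b) (Fin b) F) +
        kronecker (1 : Matrix (Fin a) (Fin a) F) (nilBlock F b))
      (blockDiagonal' fun n : Fin a => nilBlock F (chainLength F a b n)) := by
  choose f hdeg heval hvan using fun n => hasGenerator_chainLength (F := F) a b n
  -- The row `(n, k)` holds the coordinates of `(x + y) ^ k * f_n` in the monomial basis; acting on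
  -- rows from the right, the two Kronecker products are multiplication by `x` and by `y`.
  let P : Matrix (Σ n : Fin a, Fin (chainLength F a b n)) (Fin a × Fin b) F :=
    Matrix.of fun x y => chainCoeff (f x.1) x.1 x.2 y.1 y.2
  have hcard : Fintype.card (Σ n : Fin a, Fin (chainLength F a b n)) =
      Fintype.card (Fin a × Fin b) := by
    rw [Fintype.card_sigma, Fintype.card_prod]
    simp only [Fintype.card_fin]
    rw [Fin.sum_univ_eq_sum_range (fun n => chainLength F a b n), sum_chainLength hab]
  have hinj : ∀ c, c ᵥ* P = 0 → c = 0 := by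
    intro c hc
    -- A linear relation splits into its homogeneous components; in degree `d` the chain `n`
    -- contributes only its member `k = d - n`.
    have key : ∀ d : ℕ, ∀ n,
        (if h : n < a ∧ n ≤ d ∧ d < n + chainLength F a b n then
          c ⟨⟨n, h.1⟩, ⟨d - n, by have := h.2; simp only; omega⟩⟩ else 0) = 0 := by
      intro d
      refine chain_linearIndependent (a := a) (b := b) (d := d) (f := f) (fun n _ => hdeg n)
        (fun n _ => heval n) (fun n hn => dif_neg hn) ?_
      intro i hi hd
      rw [finsetSum_coeff, Finset.sum_range]
      rcases le_or_gt i d with hid | hid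
      · have h1 := congrFun hc (⟨i, hi⟩, ⟨d - i, by omega⟩)
        rw [vecMul, dotProduct, Fintype.sum_sigma] at h1
        refine Eq.trans (Finset.sum_congr rfl fun n _ => ?_) h1
        rw [coeff_C_mul]
        simp only [P, of_apply, chainCoeff, Nat.add_sub_cancel' hid]
        split_ifs with h
        · rw [Finset.sum_eq_single ⟨d - n, by omega⟩]
          · simp only
            rw [if_pos (by omega)]
          · intro k _ hk
            rw [if_neg, mul_zero]
            intro h'
            refine hk (Fin.ext ?_)
            simp only
            omega
          · simp
        · rw [zero_mul, Finset.sum_eq_zero]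
          intro k _
          rw [if_neg, mul_zero]
          intro h'
          have := k.2
          exact h ⟨n.2, by omega, by omega⟩
      · refine Finset.sum_eq_zero fun n _ => ?_
        rw [coeff_C_mul]
        split_ifs with h
        · rw [coeff_eq_zero_of_natDegree_lt, mul_zero]
          refine (natDegree_one_add_X_pow_mul_le (hdeg n)).trans_lt ?_
          omega
        · rw [zero_mul]
    funext ⟨n, k⟩
    have h1 := key (n + k) n
    rw [dif_pos ⟨n.2, by omega, by omega⟩] at h1
    rw [Pi.zero_apply, ← h1]
    congr 2
    exact Fin.ext (by simp)
  obtain ⟨Q, hPQ, hQP⟩ := exists_inverse_of_vecMul_eq_zero hcard hinj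
  refine ⟨P, Q, hPQ, hQP, ?_⟩
  have hmul : P * (kronecker (nilBlock F a) (1 : Matrix (Fin b) (Fin b) F) +
        kronecker (1 : Matrix (Fin a) (Fin a) F) (nilBlock F b)) =
      (blockDiagonal' fun n : Fin a => nilBlock F (chainLength F a b n)) * P := by
    ext ⟨n, k⟩ ⟨i, j⟩
    rw [Matrix.mul_add, Matrix.add_apply, Matrix.mul_apply, Matrix.mul_apply, Matrix.mul_apply,
      Fintype.sum_prod_type, Fintype.sum_prod_type_right, Fintype.sum_sigma]
    have h1 : ∑ x : Fin a, ∑ y : Fin b, P ⟨n, k⟩ (x, y) *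
        kronecker (nilBlock F a) (1 : Matrix (Fin b) (Fin b) F) (x, y) (i, j) =
        ∑ x : Fin a, chainCoeff (f n) n k x j * nilBlock F a x i := by
      refine Finset.sum_congr rfl fun x _ => ?_
      simp [kronecker, kroneckerMap_apply, Matrix.one_apply, P]
    have h2 : ∑ y : Fin b, ∑ x : Fin a, P ⟨n, k⟩ (x, y) *
        kronecker (1 : Matrix (Fin a) (Fin a) F) (nilBlock F b) (x, y) (i, j) =
        ∑ y : Fin b, chainCoeff (f n) n k i y * nilBlock F b y j := by
      refine Finset.sum_congr rfl fun y _ => ?_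
      simp [kronecker, kroneckerMap_apply, Matrix.one_apply, P]
    have h3 : ∑ x : Fin a, ∑ y : Fin (chainLength F a b x),
        (blockDiagonal' fun n : Fin a => nilBlock F (chainLength F a b n)) ⟨n, k⟩ ⟨x, y⟩ *
          P ⟨x, y⟩ (i, j) =
        ∑ y : Fin (chainLength F a b n), nilBlock F (chainLength F a b n) k y *
          chainCoeff (f n) n y i j := by
      rw [Finset.sum_eq_single n]
      · refine Finset.sum_congr rfl fun y _ => ?_
        rw [blockDiagonal'_apply_eq]
        rfl
      · intro x _ hx
        refine Finset.sum_eq_zero fun y _ => ?_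
        rw [blockDiagonal'_apply_ne _ _ _ hx.symm, zero_mul]
      · simp
    rw [h1, h2, h3, sum_mul_nilBlock F (fun x => chainCoeff (f n) n k x j),
      sum_mul_nilBlock F (fun y => chainCoeff (f n) n k i y),
      sum_nilBlock_mul F (fun y => chainCoeff (f n) n y i j), chainCoeff_succ (hdeg n)]
    split_ifs with h
    · rfl
    -- At the end of a chain the next power of `x + y` lands in the ideal.
    · have hk : (k : ℕ) + 1 = chainLength F a b n := by omega
      rw [hk, chainCoeff]
      split_ifs with h'
      · exact hvan n i i.2 (by omega)
      · rfl
  rw [hmul, Matrix.mul_assoc, hPQ, Matrix.mul_one]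

variable (F) in
theorem isJordanPartition_chainLength {a b : ℕ} (hab : a ≤ b) :
    IsJordanPartition F a b fun n => chainLength F a b n := by
  refine ⟨fun i j h => chainLength_antitone a b h,
    fun i => chainLength_pos i.2 (i.2.trans_le hab), ?_⟩
  rw [blockDiagonal'_jordanBlock]
  exact (areSimilar_kronecker_jordanBlock F a b).trans
    (areSimilar_blockDiagonal'_chainLength F hab).one_add

end JordanBasis

end NormanPermutation

namespace NormanPermutation

/-! ### From chain lengths to Norman permutations. -/

section NormanPerm

variable {F : Type*} [Field F]

theorem isNormanPerm_iff {a b : ℕ} (hab : a ≤ b) {σ : Equiv.Perm ℕ} :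
    IsNormanPerm F a b σ ↔ (∀ i < a, σ (i + 1) = dualDegree F a b i + 1) ∧
      ∀ n, n ∉ Finset.Icc 1 a → σ n = n := by
  have hval : ∀ i < a, (σ (i + 1) = dualDegree F a b i + 1 ↔
      ((σ (i + 1) : ℕ) : ℤ) =
        ((a : ℤ) + 1 - ((i : ℤ) + 1)) + (b : ℤ) - (chainLength F a b i : ℤ)) := by
    intro i hi
    have := add_chainLength_add_dualDegree (F := F) hi hab
    omega
  constructor
  · rintro ⟨lam, hlam, h1, h2⟩
    obtain rfl := hlam.unique (isJordanPartition_chainLength F hab)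
    exact ⟨fun i hi => (hval i hi).2 (h1 ⟨i, hi⟩), h2⟩
  · rintro ⟨h1, h2⟩
    exact ⟨_, isJordanPartition_chainLength F hab,
      fun i => (hval i i.2).1 (h1 i i.2), h2⟩

variable (F) in
theorem exists_isNormanPerm {a b : ℕ} (hab : a ≤ b) : ∃ σ, IsNormanPerm F a b σ := by
  let e : Fin a ≃ {n : ℕ // 1 ≤ n ∧ n ≤ a} :=
    { toFun := fun i => ⟨i + 1, by omega⟩
      invFun := fun n => ⟨n - 1, by have := n.2; omega⟩
      left_inv := fun i => Fin.ext (by simp)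
      right_inv := fun n => Subtype.ext (Nat.sub_add_cancel n.2.1) }
  have hinj : Function.Injective
      (fun i : Fin a => (⟨dualDegree F a b i, dualDegree_lt i.2 hab⟩ : Fin a)) := by
    intro i i' h
    exact Fin.ext (dualDegree_injOn hab (by simp) (by simp) (Fin.mk.inj h))
  let τ : Equiv.Perm (Fin a) := Equiv.ofBijective _ (Finite.injective_iff_bijective.1 hinj)
  refine ⟨τ.extendDomain e, (isNormanPerm_iff hab).2 ⟨fun i hi => ?_, fun n hn => ?_⟩⟩
  · exact Equiv.Perm.extendDomain_apply_image τ e ⟨i, hi⟩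
  · exact Equiv.Perm.extendDomain_apply_not_subtype τ e (by simpa using hn)

theorem IsNormanPerm.unique {a b : ℕ} (hab : a ≤ b) {σ τ : Equiv.Perm ℕ}
    (hσ : IsNormanPerm F a b σ) (hτ : IsNormanPerm F a b τ) : σ = τ := by
  rw [isNormanPerm_iff hab] at hσ hτ
  refine Equiv.ext fun n => ?_
  by_cases hn : n ∈ Finset.Icc 1 a
  · obtain ⟨h1, h2⟩ := Finset.mem_Icc.1 hn
    obtain ⟨i, rfl⟩ := Nat.exists_eq_add_of_le' h1
    rw [hσ.1 i (by omega), hτ.1 i (by omega)]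
  · rw [hσ.2 n hn, hτ.2 n hn]

theorem IsNormanPerm.map {K : Type*} [Field K] (f : F →+* K) {a b : ℕ} {σ : Equiv.Perm ℕ}
    (h : IsNormanPerm F a b σ) : IsNormanPerm K a b σ := by
  obtain ⟨lam, hlam, h⟩ := h
  exact ⟨lam, hlam.map f, h⟩

theorem isNormanPerm_normanPerm (p : ℕ) [Fact p.Prime] {a b : ℕ} (hab : a ≤ b) :
    IsNormanPerm (ZMod p) a b (normanPerm p a b) :=
  Classical.epsilon_spec (exists_isNormanPerm (ZMod p) hab)

/-- A similarity over `ZMod p` remains one over `F`, so independence of the field follows from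
uniqueness over `F`. -/
theorem isNormanPerm_iff_eq_normanPerm (p : ℕ) [Fact p.Prime] [CharP F p] {a b : ℕ}
    (hab : a ≤ b) (σ : Equiv.Perm ℕ) : IsNormanPerm F a b σ ↔ σ = normanPerm p a b := by
  have h := (isNormanPerm_normanPerm p hab).map (ZMod.castHom dvd_rfl F)
  exact ⟨fun hσ => hσ.unique hab h, fun hσ => hσ ▸ h⟩

theorem Rev_apply (i j n : ℕ) : Rev i j n = if i ≤ n ∧ n ≤ j then i + j - n else n := rfl

theorem Rev_symm (i j : ℕ) : (Rev i j).symm = Rev i j := rfl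

theorem dualDegree_mul_pow_add (p : ℕ) [Fact p.Prime] [CharP F p] {m r N t n : ℕ}
    (hr : r ≤ p ^ m) (htr : t ≤ r) (hN : N ≠ 0) (hn : n < r) :
    dualDegree F r (N * p ^ m + t) n = if n < t then dualDegree F t r n else r + t - 1 - n := by
  unfold dualDegree
  split_ifs with h
  · rw [chainLength_mul_pow_add p hr htr h]
    omega
  · rw [chainLength_mul_pow_add_of_le p hr htr hN (by omega) hn]
    omega

theorem dualDegree_mul_pow_sub (p : ℕ) [Fact p.Prime] [CharP F p] {m r N t n : ℕ}
    (hr : r ≤ p ^ m) (htr : t ≤ r) (hN : 2 ≤ N) (hn : n < r) :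
    dualDegree F r (N * p ^ m - t) n =
      if n < r - t then r - t - 1 - n else r - 1 - dualDegree F t r (r - 1 - n) := by
  have hq : 2 * p ^ m ≤ N * p ^ m := Nat.mul_le_mul_right _ hN
  have h0 := add_chainLength_add_dualDegree (F := F) (b := N * p ^ m - t) hn (by omega)
  split_ifs with h
  · rw [chainLength_mul_pow_sub_of_lt p hr htr hN h] at h0
    omega
  · have h1 := chainLength_mul_pow_sub (F := F) p hr htr hN (j := r - 1 - n) (by omega)
    rw [show r - 1 - (r - 1 - n) = n by omega] at h1
    rw [h1] at h0
    have h2 := add_chainLength_add_dualDegree (F := F) (a := t) (n := r - 1 - n) (by omega) htr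
    have h3 := dualDegree_lt (F := F) (a := t) (n := r - 1 - n) (by omega) htr
    omega

theorem normanPerm_mul_pow_add (p : ℕ) [Fact p.Prime] {m r N t : ℕ} (hr : r ≤ p ^ m)
    (htr : t ≤ r) (hN : N ≠ 0) :
    normanPerm p r (N * p ^ m + t) = (normanPerm p t r).trans (Rev (t + 1) r) := by
  have hq : p ^ m ≤ N * p ^ m := Nat.le_mul_of_pos_left _ (by omega)
  obtain ⟨h1, h2⟩ := (isNormanPerm_iff htr).1 (isNormanPerm_normanPerm p htr)
  simp only [Finset.mem_Icc] at h2
  symm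
  rw [← isNormanPerm_iff_eq_normanPerm (F := ZMod p) p (by omega), isNormanPerm_iff (by omega)]
  refine ⟨fun i hi => ?_, fun n hn => ?_⟩
  · rw [dualDegree_mul_pow_add p hr htr hN hi, Equiv.trans_apply]
    split_ifs with h
    · have := dualDegree_lt (F := ZMod p) h htr
      rw [h1 i h, Rev_apply, if_neg (by omega)]
    · rw [h2 (i + 1) (by omega), Rev_apply, if_pos (by omega)]
      omega
  · rw [Finset.mem_Icc] at hn
    rw [Equiv.trans_apply, h2 n (by omega), Rev_apply, if_neg (by omega)]

theorem normanPerm_mul_pow_sub (p : ℕ) [Fact p.Prime] {m r N t : ℕ} (hr : r ≤ p ^ m)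
    (htr : t ≤ r) (hN : 2 ≤ N) :
    normanPerm p r (N * p ^ m - t) = (Rev 1 (r - t)).trans
      ((Rev 1 r).symm.trans ((normanPerm p t r).trans (Rev 1 r))) := by
  have hq : 2 * p ^ m ≤ N * p ^ m := Nat.mul_le_mul_right _ hN
  obtain ⟨h1, h2⟩ := (isNormanPerm_iff htr).1 (isNormanPerm_normanPerm p htr)
  simp only [Finset.mem_Icc] at h2
  symm
  rw [← isNormanPerm_iff_eq_normanPerm (F := ZMod p) p (by omega), isNormanPerm_iff (by omega)]
  simp only [Rev_symm, Equiv.trans_apply]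
  refine ⟨fun i hi => ?_, fun n hn => ?_⟩
  · rw [dualDegree_mul_pow_sub p hr htr hN hi]
    split_ifs with h
    · rw [Rev_apply 1 (r - t), if_pos (by omega), Rev_apply 1 r (1 + (r - t) - (i + 1)),
        if_pos (by omega), h2 _ (by omega), Rev_apply, if_pos (by omega)]
      omega
    · have h3 := dualDegree_lt (F := ZMod p) (a := t) (n := r - 1 - i) (by omega) htr
      rw [Rev_apply 1 (r - t), if_neg (by omega), Rev_apply 1 r (i + 1), if_pos (by omega),
        show 1 + r - (i + 1) = r - 1 - i + 1 by omega, h1 _ (by omega), Rev_apply,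
        if_pos (by omega)]
      omega
  · rw [Finset.mem_Icc] at hn
    rw [Rev_apply 1 (r - t), if_neg (by omega), Rev_apply 1 r n, if_neg (by omega),
      h2 n (by omega), Rev_apply, if_neg (by omega)]

end NormanPerm

end NormanPermutation

/-- Permutations act on the right: `f.trans g` is `f` followed by `g`, and
`g.symm.trans (f.trans g)` is the conjugate `f ^ g`. The first three conjuncts of the conclusion
say that the three Norman permutations are well defined, over each field of characteristic `p`;
the last two are the reduction formulas. -/
theorem propositionT (p : ℕ) [Fact p.Prime] (F : Type*) [Field F] [CharP F p]
    (m r s₀ s₁ s s' : ℕ) (hs₀ : 1 ≤ s₀) (hs₀p : s₀ < p) (hs₁ : 1 ≤ s₁) (hs₁r : s₁ < r)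
    (hr : r < p ^ m) (hs : s = s₀ * p ^ m + s₁) (hs' : s' = (s₀ + 1) * p ^ m - s₁) :
    (∀ σ : Equiv.Perm ℕ, NormanPermutation.IsNormanPerm F s₁ r σ ↔
      σ = NormanPermutation.normanPerm p s₁ r) ∧
    (∀ σ : Equiv.Perm ℕ, NormanPermutation.IsNormanPerm F r s σ ↔
      σ = NormanPermutation.normanPerm p r s) ∧
    (∀ σ : Equiv.Perm ℕ, NormanPermutation.IsNormanPerm F r s' σ ↔
      σ = NormanPermutation.normanPerm p r s') ∧
    NormanPermutation.normanPerm p r s =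
      (NormanPermutation.normanPerm p s₁ r).trans (NormanPermutation.Rev (s₁ + 1) r) ∧
    NormanPermutation.normanPerm p r s' =
      (NormanPermutation.Rev 1 (r - s₁)).trans
        ((NormanPermutation.Rev 1 r).symm.trans
          ((NormanPermutation.normanPerm p s₁ r).trans (NormanPermutation.Rev 1 r))) := by
  subst hs hs'
  -- These bounds give `r ≤ s` and `r ≤ s'`, as the chain description of the partition requires.
  have h1 : p ^ m ≤ s₀ * p ^ m := Nat.le_mul_of_pos_left _ hs₀
  have h2 : 2 * p ^ m ≤ (s₀ + 1) * p ^ m := Nat.mul_le_mul_right _ (by omega)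
  exact ⟨NormanPermutation.isNormanPerm_iff_eq_normanPerm p hs₁r.le,
    NormanPermutation.isNormanPerm_iff_eq_normanPerm p (by omega),
    NormanPermutation.isNormanPerm_iff_eq_normanPerm p (by omega),
    NormanPermutation.normanPerm_mul_pow_add p hr.le hs₁r.le (by omega),
    NormanPermutation.normanPerm_mul_pow_sub p hr.le hs₁r.le (by omega)⟩
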